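/- Let $n_1,n_2\ge 1$, $n=n_1+n_2$, and let $$A=\begin{bmatrix}A_1&0\\T&A_2\end{bmatrix}$$ be a real $n\times n$ matrix, where $A_1$ is $n_1\times n_1$, $A_2$ is $n_2\times n_2$ and $T$ is $n_2\times n_1$, such that $|\det A|>1$, $|\det A_1|>1$ and $|\det A_2|<1$. Let $\Gamma\subset\mathbb{R}^n=\mathbb{R}^{n_1}\times\mathbb{R}^{n_2}$ be a full-rank lattice (the image of $\mathbb{Z}^n$ under an invertible linear map) such that $\Gamma\cap(\{0\}\times\mathbb{R}^{n_2})$ has rank $n_2$. Then there is no $(A,\Gamma)$ wavelet set; that is, there is no Lebesgue measurable set $W\subset\mathbb{R}^n$ such that for almost every $x\in\mathbb{R}^n$ $$\sum_{j\in\mathbb{Z}}\mathbf 1_W(A^jx)=1\qquad\text{and}\qquad\sum_{\gamma\in\Gamma}\mathbf 1_W(x+\gamma)=1 .$$ -/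

import Mathlib

open MeasureTheory
open scoped ENNReal

noncomputable section

/-- `U` packs `M`-redundantly by `A` dilations: `∑_{j ∈ ℤ} 1_U(A^j x) ≤ M` for a.e. `x`.
The sum is taken in `[0, ∞]`, so it always has its true value. -/
def PacksByDilations {ι : Type*} [Fintype ι] [DecidableEq ι]
    (M : ℕ) (A : Matrix ι ι ℝ) (U : Set (ι → ℝ)) : Prop :=
  ∀ᵐ x : ι → ℝ, ∑' j : ℤ, U.indicator (fun _ => (1 : ℝ≥0∞)) ((A ^ j).mulVec x) ≤ (M : ℝ≥0∞)

/-- `U` covers by `A` dilations: `∑_{j ∈ ℤ} 1_U(A^j x) ≥ 1` for a.e. `x`. -/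
def CoversByDilations {ι : Type*} [Fintype ι] [DecidableEq ι]
    (A : Matrix ι ι ℝ) (U : Set (ι → ℝ)) : Prop :=
  ∀ᵐ x : ι → ℝ, 1 ≤ ∑' j : ℤ, U.indicator (fun _ => (1 : ℝ≥0∞)) ((A ^ j).mulVec x)

/-- `U` tiles by `A` dilations: it both packs (with `M = 1`) and covers. -/
def TilesByDilations {ι : Type*} [Fintype ι] [DecidableEq ι]
    (A : Matrix ι ι ℝ) (U : Set (ι → ℝ)) : Prop :=
  PacksByDilations 1 A U ∧ CoversByDilations A U

/-- `V` packs `M`-redundantly by `Γ` translations: `∑_{γ ∈ Γ} 1_V(x + γ) ≤ M` for a.e. `x`. -/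
def PacksByTranslations {ι : Type*} [Fintype ι]
    (M : ℕ) (Γ : Submodule ℤ (ι → ℝ)) (V : Set (ι → ℝ)) : Prop :=
  ∀ᵐ x : ι → ℝ, ∑' γ : Γ, V.indicator (fun _ => (1 : ℝ≥0∞)) (x + (γ : ι → ℝ)) ≤ (M : ℝ≥0∞)

/-- `V` covers by `Γ` translations: `∑_{γ ∈ Γ} 1_V(x + γ) ≥ 1` for a.e. `x`. -/
def CoversByTranslations {ι : Type*} [Fintype ι]
    (Γ : Submodule ℤ (ι → ℝ)) (V : Set (ι → ℝ)) : Prop :=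
  ∀ᵐ x : ι → ℝ, 1 ≤ ∑' γ : Γ, V.indicator (fun _ => (1 : ℝ≥0∞)) (x + (γ : ι → ℝ))

/-- `V` tiles by `Γ` translations: it both packs (with `M = 1`) and covers. -/
def TilesByTranslations {ι : Type*} [Fintype ι]
    (Γ : Submodule ℤ (ι → ℝ)) (V : Set (ι → ℝ)) : Prop :=
  PacksByTranslations 1 Γ V ∧ CoversByTranslations Γ V

/-- `W` is an `(A, Γ)` wavelet set: a Lebesgue measurable set that tiles both by `A` dilations and
by `Γ` translations. (`NullMeasurableSet` for `volume` is Lebesgue measurability.) -/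
structure IsWaveletSet {ι : Type*} [Fintype ι] [DecidableEq ι]
    (A : Matrix ι ι ℝ) (Γ : Submodule ℤ (ι → ℝ)) (W : Set (ι → ℝ)) : Prop where
  measurable : NullMeasurableSet W volume
  tiles_dilations : TilesByDilations A W
  tiles_translations : TilesByTranslations Γ W

/-- The subspace `{0} × ℝ^{n₂}` of `ℝ^{n₁} × ℝ^{n₂} = ℝ^{n₁ + n₂}`; the coordinates of the latter
are indexed by `Fin n₁ ⊕ Fin n₂`. -/
def zeroProd (n₁ n₂ : ℕ) : Submodule ℝ (Fin n₁ ⊕ Fin n₂ → ℝ) where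
  carrier := {x | ∀ i : Fin n₁, x (Sum.inl i) = 0}
  add_mem' hx hy i := by simp [hx i, hy i]
  zero_mem' _ := rfl
  smul_mem' c x hx i := by simp [hx i]

end

/-! A wavelet set `W` would make a set of infinite measure finite. Packing by `Γ` gives `volume W`
finite. Take the cylinder over a ball `K` of `ℝ^{n₁}`, of infinite measure, covered by the preimages
of `W` under `A ^ j`. For `j = k ≥ 0` the preimage has measure `|det A|⁻ᵏ * volume W`. For `j = -k`,
the part in the cylinder is the image under `A ^ k` of the part of `W` over `E = A₁⁻ᵏ K`. Packing by
the rank `n₂` sublattice in `{0} × ℝ^{n₂}` (`PacksByTranslations.measure_inter_le`) bounds that part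
by `volume E * volume D`, so the piece is at most `|det A|ᵏ |det A₁|⁻ᵏ = |det A₂|ᵏ` times a
constant. Both geometric series converge. -/

open scoped Pointwise

/-- If `W` packs `M`-redundantly by `Γ`, then its part in a set `S` invariant under a subgroup
`Λ ≤ Γ` is at most `M` times the part of `S` in a fundamental domain of `Λ`. -/
theorem PacksByTranslations.measure_inter_le {ι : Type*} [Fintype ι] {M : ℕ}
    {Γ : Submodule ℤ (ι → ℝ)} {W : Set (ι → ℝ)} (hW : PacksByTranslations M Γ W)
    (hWm : NullMeasurableSet W volume) {Λ : AddSubgroup (ι → ℝ)} [Countable Λ]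
    (hΛ : ∀ x ∈ Λ, x ∈ Γ) {D : Set (ι → ℝ)} (hD : IsAddFundamentalDomain Λ D volume)
    {S : Set (ι → ℝ)} (hSΛ : ∀ γ ∈ Λ, ∀ x, x + γ ∈ S ↔ x ∈ S) :
    volume (W ∩ S) ≤ M * volume (S ∩ D) := by
  have hmeas (γ : Λ) : NullMeasurableSet {x | x + (γ : ι → ℝ) ∈ W} volume :=
    hWm.preimage (measurePreserving_add_right volume (γ : ι → ℝ)).quasiMeasurePreserving
  have hterm (γ : Λ) : volume ((-γ +ᵥ (W ∩ S)) ∩ D) =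
      ∫⁻ x in S ∩ D, W.indicator (fun _ => (1 : ℝ≥0∞)) (x + (γ : ι → ℝ)) := by
    have hset : (-γ +ᵥ (W ∩ S)) ∩ D = {x | x + (γ : ι → ℝ) ∈ W} ∩ (S ∩ D) := by
      ext x
      have hx : - -(γ : ι → ℝ) + x = x + γ := by rw [neg_neg, add_comm]
      simp only [Set.mem_inter_iff, Set.mem_vadd_set_iff_neg_vadd_mem, Set.mem_ofPred_eq,
        AddSubgroup.vadd_def, NegMemClass.coe_neg, vadd_eq_add, hx, hSΛ γ γ.2 x, and_assoc]
    have hind : (fun x => W.indicator (fun _ => (1 : ℝ≥0∞)) (x + (γ : ι → ℝ))) =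
        {x | x + (γ : ι → ℝ) ∈ W}.indicator 1 := by
      ext x; simp [Set.indicator]
    have hγ : NullMeasurableSet {x | x + (γ : ι → ℝ) ∈ W} (volume.restrict (S ∩ D)) := (hmeas γ).mono_ac 
      Measure.restrict_le_self.absolutelyContinuous
    rw [hset, hind, lintegral_indicator_one₀ hγ, Measure.restrict_apply₀ hγ]
  -- Cut `W ∩ S` along the translates of `D`; replacing `γ` by `-γ` produces the terms `x + γ` of
  -- the packing sum.
  rw [hD.measure_eq_tsum, ← (Equiv.neg Λ).tsum_eq]
  simp only [Equiv.neg_apply, hterm]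
  rw [← lintegral_tsum]
  · calc _ ≤ ∫⁻ _ in S ∩ D, (M : ℝ≥0∞) := by
          refine lintegral_mono_ae (ae_restrict_of_ae ?_)
          filter_upwards [hW] with x hx
          exact (ENNReal.tsum_comp_le_tsum_of_injective
            (f := fun γ : Λ => (⟨γ, hΛ γ γ.2⟩ : Γ))
            (fun a b h => Subtype.ext (Subtype.mk.inj h))
            (fun γ : Γ => W.indicator (fun _ => (1 : ℝ≥0∞)) (x + (γ : ι → ℝ)))).trans hx
      _ = M * volume (S ∩ D) := by rw [setLIntegral_const]
  · intro γ
    refine AEMeasurable.restrict ?_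
    exact (aemeasurable_const.indicator₀ (hmeas γ) : AEMeasurable ({x | x + (γ : ι → ℝ) ∈ W}.indicator
      (fun _ => (1 : ℝ≥0∞))) volume)

theorem PacksByTranslations.measure_ne_top {ι : Type*} [Fintype ι] {M : ℕ}
    {Γ : Submodule ℤ (ι → ℝ)} [DiscreteTopology Γ] [IsZLattice ℝ Γ] {W : Set (ι → ℝ)}
    (hW : PacksByTranslations M Γ W) (hWm : NullMeasurableSet W volume) : volume W ≠ ∞ := by
  let b := Module.Free.chooseBasis ℤ Γ
  have : Countable Γ.toAddSubgroup := inferInstanceAs (Countable Γ)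
  have hD : IsAddFundamentalDomain Γ.toAddSubgroup
      (ZSpan.fundamentalDomain (b.ofZLatticeBasis ℝ)) volume :=
    ZLattice.isAddFundamentalDomain b volume
  have h := hW.measure_inter_le hWm (fun _ hx => hx) hD (S := Set.univ) (by simp)
  rw [Set.inter_univ, Set.univ_inter] at h
  exact ne_top_of_le_ne_top (ENNReal.mul_ne_top (ENNReal.natCast_ne_top M)
    (ZSpan.fundamentalDomain_isBounded _).measure_lt_top.ne) h

theorem volume_setOf_comp_inl_inr {m n : Type*} [Fintype m] [Fintype n] (E : Set (m → ℝ))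
    (D : Set (n → ℝ)) :
    volume {x : m ⊕ n → ℝ | x ∘ Sum.inl ∈ E ∧ x ∘ Sum.inr ∈ D} = volume E * volume D := by
  have h := (volume_measurePreserving_sumPiEquivProdPi (fun _ : m ⊕ n => ℝ)).measure_preimage_equiv
    (E ×ˢ D)
  rw [Measure.volume_eq_prod, Measure.prod_prod] at h
  exact h

theorem volume_preimage_mulVec {ι : Type*} [Fintype ι] [DecidableEq ι] {B : Matrix ι ι ℝ}
    (hB : B.det ≠ 0) {W : Set (ι → ℝ)} (hW : NullMeasurableSet W volume) :
    volume {x | B.mulVec x ∈ W} = ENNReal.ofReal |B.det⁻¹| * volume W := by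
  have hmap := Real.map_matrix_volume_pi_eq_smul_volume_pi hB
  have hm : Measurable (Matrix.toLin' B) :=
    (LinearMap.continuous_of_finiteDimensional _).measurable
  have hac : Measure.map (Matrix.toLin' B) volume ≪ volume := by
    rw [hmap]; exact Measure.smul_absolutelyContinuous
  have := Measure.map_apply₀ hm.aemeasurable (hW.mono_ac hac)
  rw [hmap] at this
  exact this.symm

theorem nullMeasurableSet_preimage_mulVec {ι : Type*} [Fintype ι] [DecidableEq ι]
    {B : Matrix ι ι ℝ} (hB : B.det ≠ 0) {W : Set (ι → ℝ)} (hW : NullMeasurableSet W volume) :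
    NullMeasurableSet {x | B.mulVec x ∈ W} volume := by
  have hm : Measurable (Matrix.toLin' B) :=
    (LinearMap.continuous_of_finiteDimensional _).measurable
  refine hW.preimage (f := Matrix.toLin' B) ⟨hm, ?_⟩
  rw [Real.map_matrix_volume_pi_eq_smul_volume_pi hB]
  exact Measure.smul_absolutelyContinuous

theorem measurable_mulVec {ι : Type*} [Fintype ι] [DecidableEq ι] (B : Matrix ι ι ℝ) :
    Measurable (fun x : ι → ℝ => B.mulVec x) :=
  (LinearMap.continuous_of_finiteDimensional (Matrix.toLin' B)).measurable

/-- The embedding of the second factor of a product. -/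
def sumInr (m n : Type*) : (n → ℝ) →ₗ[ℝ] (m ⊕ n → ℝ) where
  toFun x := Sum.elim 0 x
  map_add' x y := by ext (i | i) <;> simp
  map_smul' c x := by ext (i | i) <;> simp

/-- A lattice meeting `{0} × ℝ^{n₂}` in rank `n₂` has, for this intersection, a fundamental domain
of the form `ℝ^{n₁} × D` with `D` bounded. -/
theorem exists_isAddFundamentalDomain_inf_zeroProd {n₁ n₂ : ℕ}
    (Γ : Submodule ℤ (Fin n₁ ⊕ Fin n₂ → ℝ)) [DiscreteTopology Γ]
    (hrank : Module.finrank ℤ ↥(Γ ⊓ (zeroProd n₁ n₂).restrictScalars ℤ) = n₂) :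
    ∃ D : Set (Fin n₂ → ℝ), volume D ≠ ∞ ∧
      IsAddFundamentalDomain (Γ ⊓ (zeroProd n₁ n₂).restrictScalars ℤ).toAddSubgroup
        {x : Fin n₁ ⊕ Fin n₂ → ℝ | x ∘ Sum.inr ∈ D} volume := by
  let e := sumInr (Fin n₁) (Fin n₂)
  have he : Function.Injective e := fun x y h => by
    ext i; exact congrFun h (Sum.inr i)
  let L : Submodule ℤ (Fin n₂ → ℝ) := Γ.comap (e.restrictScalars ℤ)
  have : DiscreteTopology L := DiscreteTopology.preimage_of_continuous_injective
    (Γ : Set (Fin n₁ ⊕ Fin n₂ → ℝ)) (LinearMap.continuous_of_finiteDimensional e) he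
  have hmap : L.map (e.restrictScalars ℤ) = Γ ⊓ (zeroProd n₁ n₂).restrictScalars ℤ := by
    ext x
    constructor
    · rintro ⟨y, hy, rfl⟩
      exact ⟨hy, fun i => rfl⟩
    · rintro ⟨hx, hx'⟩
      have hxe : e (x ∘ Sum.inr) = x := by
        ext (i | i)
        · exact (hx' i).symm
        · rfl
      refine ⟨x ∘ Sum.inr, ?_, hxe⟩
      change e (x ∘ Sum.inr) ∈ Γ
      rwa [hxe]
  have hfin : Module.finrank ℤ L = n₂ := by
    refine (Submodule.equivMapOfInjective (e.restrictScalars ℤ) he L).finrank_eq.trans ?_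
    rw [hmap, hrank]
  -- For a discrete subgroup, the dimension of the real span equals the `ℤ`-rank, so rank `n₂`
  -- forces `L` to span `ℝ^{n₂}`.
  have : IsZLattice ℝ L := ⟨by
    have hd : DiscreteTopology (Submodule.span ℤ (L : Set (Fin n₂ → ℝ))) := by
      rwa [Submodule.span_eq]
    have h := Real.finrank_eq_int_finrank_of_discrete hd
    rw [Set.finrank, Set.finrank, Submodule.span_eq, hfin] at h
    exact Submodule.eq_top_of_finrank_eq (by simp [h])⟩
  let b := Module.Free.chooseBasis ℤ L
  let D := ZSpan.fundamentalDomain (b.ofZLatticeBasis ℝ)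
  refine ⟨D, (ZSpan.fundamentalDomain_isBounded _).measure_lt_top.ne, ?_⟩
  refine IsAddFundamentalDomain.mk' ?_ ?_
  · have hproj : Measurable fun x : Fin n₁ ⊕ Fin n₂ → ℝ => x ∘ Sum.inr :=
      measurable_pi_lambda _ fun i => measurable_pi_apply _
    exact (hproj (ZSpan.fundamentalDomain_measurableSet (b.ofZLatticeBasis ℝ))).nullMeasurableSet
  · intro x
    obtain ⟨⟨v, hv⟩, hvD, huniq⟩ :=
      ZSpan.exist_unique_vadd_mem_fundamentalDomain (b.ofZLatticeBasis ℝ) (x ∘ Sum.inr)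
    have hvL : v ∈ L := by rwa [b.ofZLatticeBasis_span ℝ] at hv
    refine ⟨⟨e v, (hmap.le ⟨v, hvL, rfl⟩ : _)⟩, hvD, ?_⟩
    rintro ⟨w, hw⟩ hwD
    obtain ⟨u, hu, rfl⟩ := hmap.ge hw
    have hu' : u ∈ Submodule.span ℤ (Set.range (b.ofZLatticeBasis ℝ)) := by
      rwa [b.ofZLatticeBasis_span ℝ]
    have huv := huniq ⟨u, hu'⟩ hwD
    exact Subtype.ext (congrArg e (congrArg Subtype.val huv))

theorem fromBlocks_zero_pow_mulVec_comp_inl {m n : Type*} [Fintype m] [Fintype n] [DecidableEq m]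
    [DecidableEq n] (A₁ : Matrix m m ℝ) (T : Matrix n m ℝ) (A₂ : Matrix n n ℝ) (k : ℕ)
    (x : m ⊕ n → ℝ) :
    ((Matrix.fromBlocks A₁ 0 T A₂ ^ k).mulVec x) ∘ Sum.inl = (A₁ ^ k).mulVec (x ∘ Sum.inl) := by
  induction k with
  | zero => simp
  | succ k ih =>
    rw [pow_succ', pow_succ', ← Matrix.mulVec_mulVec, ← Matrix.mulVec_mulVec, ← ih,
      Matrix.fromBlocks_mulVec]
    ext i
    simp

theorem ENNReal.tsum_pow_ofReal_ne_top {r : ℝ} (hr : r < 1) :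
    ∑' k : ℕ, ENNReal.ofReal r ^ k ≠ ∞ := by
  rw [ENNReal.tsum_geometric, ENNReal.inv_ne_top]
  exact (tsub_pos_of_lt (by simpa using hr)).ne'

/-- The index `0` is counted twice on the right, which is harmless for an upper bound. -/
theorem ENNReal.tsum_int_le_add (f : ℤ → ℝ≥0∞) :
    ∑' j : ℤ, f j ≤ ∑' k : ℕ, f k + ∑' k : ℕ, f (-(k : ℤ)) := by
  have hf := (ENNReal.summable (f := fun k : ℕ => f k)).hasSum.of_nat_of_neg_add_one
    (ENNReal.summable (f := fun k : ℕ => f (-(k + 1 : ℤ)))).hasSum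
  rw [hf.tsum_eq]
  refine add_le_add_right ?_ _
  exact_mod_cast ENNReal.tsum_comp_le_tsum_of_injective Nat.succ_injective
    (fun k : ℕ => f (-(k : ℤ)))

theorem corollary5p2 (n₁ n₂ : ℕ)
    (A₁ : Matrix (Fin n₁) (Fin n₁) ℝ) (A₂ : Matrix (Fin n₂) (Fin n₂) ℝ)
    (T : Matrix (Fin n₂) (Fin n₁) ℝ)
    (A : Matrix (Fin n₁ ⊕ Fin n₂) (Fin n₁ ⊕ Fin n₂) ℝ)
    (hA : A = Matrix.fromBlocks A₁ 0 T A₂)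
    (hdet : 1 < |A.det|) (hdet₁ : 1 < |A₁.det|) (hdet₂ : |A₂.det| < 1)
    (Γ : Submodule ℤ (Fin n₁ ⊕ Fin n₂ → ℝ)) [DiscreteTopology Γ] [IsZLattice ℝ Γ]
    (hrank : Module.finrank ℤ ↥(Γ ⊓ (zeroProd n₁ n₂).restrictScalars ℤ) = n₂) :
    ¬ ∃ W : Set (Fin n₁ ⊕ Fin n₂ → ℝ), IsWaveletSet A Γ W := by
  rintro ⟨W, hW⟩
  have hWm := hW.measurable
  have hpack := hW.tiles_translations.1
  have hWfin : volume W ≠ ∞ := hpack.measure_ne_top hWm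
  obtain ⟨D, hDfin, hD⟩ := exists_isAddFundamentalDomain_inf_zeroProd Γ hrank
  have hdet0 : A.det ≠ 0 := by rintro h; norm_num [h] at hdet
  have hdet10 : A₁.det ≠ 0 := by rintro h; norm_num [h] at hdet₁
  have hAdet : A.det = A₁.det * A₂.det := by rw [hA, Matrix.det_fromBlocks_zero₁₂]
  -- An empty matrix has determinant `1`, so `n₂ > 0`; this makes `ℝ^{n₂}`, hence the cylinder, of
  -- infinite measure.
  have : Nonempty (Fin n₂) := by
    by_contra hn
    rw [not_nonempty_iff] at hn
    simp [Matrix.det_isEmpty] at hdet₂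
  have hdet_neg (k : ℕ) : (A ^ (-(k : ℤ))).det = (A.det ^ k)⁻¹ := by
    rw [Matrix.zpow_neg_natCast, Matrix.det_nonsing_inv, Ring.inverse_eq_inv', Matrix.det_pow]
  have hzdet (j : ℤ) : (A ^ j).det ≠ 0 := ((Ne.isUnit hdet0).det_zpow j).ne_zero
  let K : Set (Fin n₁ → ℝ) := Metric.ball 0 1
  have hK0 : volume K ≠ 0 := (Metric.measure_ball_pos volume 0 one_pos).ne'
  have hKfin : volume K ≠ ∞ := measure_ball_lt_top.ne
  let cyl (E : Set (Fin n₁ → ℝ)) : Set (Fin n₁ ⊕ Fin n₂ → ℝ) := {x | x ∘ Sum.inl ∈ E}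
  have hproj : Measurable fun x : Fin n₁ ⊕ Fin n₂ → ℝ => x ∘ Sum.inl :=
    measurable_pi_lambda _ fun i => measurable_pi_apply _
  have hcyl_vol : volume (cyl K) = ∞ := by
    have h := volume_setOf_comp_inl_inr K (Set.univ : Set (Fin n₂ → ℝ))
    simp only [Set.mem_univ, and_true] at h
    rw [h, measure_univ_of_isAddLeftInvariant, ENNReal.mul_top hK0]
  have hcyl_inter (E : Set (Fin n₁ → ℝ)) :
      volume (W ∩ cyl E) ≤ volume E * volume D := by
    have : Countable (Γ ⊓ (zeroProd n₁ n₂).restrictScalars ℤ).toAddSubgroup :=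
      (Submodule.inclusion_injective (inf_le_left : Γ ⊓ (zeroProd n₁ n₂).restrictScalars ℤ ≤ Γ)).countable
    have h := hpack.measure_inter_le hWm (Λ := (Γ ⊓ (zeroProd n₁ n₂).restrictScalars ℤ).toAddSubgroup)
      (fun _ hx => Submodule.mem_inf.1 hx |>.1) hD
      (S := cyl E) (fun γ hγ x => by
        have : (x + γ) ∘ Sum.inl = x ∘ Sum.inl := by
          ext i; simp [hγ.2 i]
        simp only [cyl, Set.mem_ofPred_eq, this])
    rw [Nat.cast_one, one_mul] at h
    exact h.trans (volume_setOf_comp_inl_inr E D).le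
  have hnonneg (k : ℕ) : volume ({x | (A ^ (k : ℤ)).mulVec x ∈ W} ∩ cyl K) ≤
      ENNReal.ofReal |A.det|⁻¹ ^ k * volume W := by
    refine (measure_mono Set.inter_subset_left).trans ?_
    rw [volume_preimage_mulVec (hzdet _) hWm, zpow_natCast, Matrix.det_pow, abs_inv, abs_pow,
      ← inv_pow, ENNReal.ofReal_pow (by positivity)]
  have hneg (k : ℕ) : volume ({x | (A ^ (-(k : ℤ))).mulVec x ∈ W} ∩ cyl K) ≤
      ENNReal.ofReal |A₂.det| ^ k * (volume K * volume D) := by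
    let E : Set (Fin n₁ → ℝ) := {z | (A₁ ^ k).mulVec z ∈ K}
    have hE : MeasurableSet E := measurable_mulVec _ measurableSet_ball
    have hEvol : volume E = ENNReal.ofReal |A₁.det|⁻¹ ^ k * volume K := by
      rw [volume_preimage_mulVec (by rw [Matrix.det_pow]; exact pow_ne_zero _ hdet10)
        measurableSet_ball.nullMeasurableSet, Matrix.det_pow, abs_inv, abs_pow,
        ← inv_pow, ENNReal.ofReal_pow (by positivity)]
    -- With `y = A⁻ᵏ x`, the first block of `x` is `A₁ᵏ` applied to that of `y`, since the upper
    -- right block of `A` vanishes.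
    have hset : {x | (A ^ (-(k : ℤ))).mulVec x ∈ W} ∩ cyl K =
        {x | (A ^ (-(k : ℤ))).mulVec x ∈ W ∩ cyl E} := by
      ext x
      have hx : (A₁ ^ k).mulVec (((A ^ (-(k : ℤ))).mulVec x) ∘ Sum.inl) = x ∘ Sum.inl := by
        have hcancel : A ^ k * A ^ (-(k : ℤ)) = 1 := by
          rw [← zpow_natCast, Matrix.zpow_neg (Ne.isUnit hdet0), Matrix.mul_nonsing_inv _
            (hzdet _).isUnit]
        rw [← fromBlocks_zero_pow_mulVec_comp_inl A₁ T A₂, ← hA, Matrix.mulVec_mulVec, hcancel,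
          Matrix.one_mulVec]
      simp only [Set.mem_inter_iff, Set.mem_ofPred_eq, cyl, E, hx]
    have hcylE : NullMeasurableSet (cyl E) volume := (hproj hE).nullMeasurableSet
    rw [hset, volume_preimage_mulVec (hzdet _) (hWm.inter hcylE)]
    have hconst : ENNReal.ofReal |(A ^ (-(k : ℤ))).det⁻¹| * ENNReal.ofReal |A₁.det|⁻¹ ^ k =
        ENNReal.ofReal |A₂.det| ^ k := by
      rw [hdet_neg, inv_inv, abs_pow,
        ENNReal.ofReal_pow (abs_nonneg _), ← mul_pow, ← ENNReal.ofReal_mul (abs_nonneg _), hAdet,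
        abs_mul, mul_right_comm, mul_inv_cancel₀ (abs_ne_zero.2 hdet10), one_mul]
    calc _ ≤ ENNReal.ofReal |(A ^ (-(k : ℤ))).det⁻¹| * (volume E * volume D) := by
          gcongr; exact hcyl_inter E
      _ = _ := by rw [hEvol, ← hconst]; ring
  have hmeas (j : ℤ) : NullMeasurableSet {x | (A ^ j).mulVec x ∈ W}
      (volume.restrict (cyl K)) :=
    (nullMeasurableSet_preimage_mulVec (hzdet j) hWm).mono_ac
      Measure.restrict_le_self.absolutelyContinuous
  -- Integrate the covering inequality over the cylinder.
  have hcover : volume (cyl K) ≤ ∑' j : ℤ, volume ({x | (A ^ j).mulVec x ∈ W} ∩ cyl K) := by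
    calc volume (cyl K) = ∫⁻ _ in cyl K, 1 := by simp
      _ ≤ ∫⁻ x in cyl K, ∑' j : ℤ,
          {x | (A ^ j).mulVec x ∈ W}.indicator (fun _ => (1 : ℝ≥0∞)) x :=
        lintegral_mono_ae (ae_restrict_of_ae hW.tiles_dilations.2)
      _ = ∑' j : ℤ, volume ({x | (A ^ j).mulVec x ∈ W} ∩ cyl K) := by
        rw [lintegral_tsum fun j => aemeasurable_const.indicator₀ (hmeas j)]
        congr 1 with j
        rw [lintegral_indicator_const₀ (hmeas j), one_mul, Measure.restrict_apply₀ (hmeas j)]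
  have hsum : ∑' j : ℤ, volume ({x | (A ^ j).mulVec x ∈ W} ∩ cyl K) ≠ ∞ := by
    refine ne_top_of_le_ne_top ?_ (ENNReal.tsum_int_le_add (fun j : ℤ => volume ({x | (A ^ j).mulVec x ∈ W} ∩ cyl K)))
    refine ENNReal.add_ne_top.2 ⟨?_, ?_⟩
    · refine ne_top_of_le_ne_top ?_ (ENNReal.tsum_le_tsum hnonneg)
      rw [ENNReal.tsum_mul_right]
      exact ENNReal.mul_ne_top (ENNReal.tsum_pow_ofReal_ne_top (inv_lt_one_of_one_lt₀ hdet)) hWfin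
    · refine ne_top_of_le_ne_top ?_ (ENNReal.tsum_le_tsum hneg)
      rw [ENNReal.tsum_mul_right]
      exact ENNReal.mul_ne_top (ENNReal.tsum_pow_ofReal_ne_top hdet₂)
        (ENNReal.mul_ne_top hKfin hDfin)
  exact hsum (top_le_iff.1 (hcyl_vol ▸ hcover))
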